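/- Let $Q=(0,1)^3$ and let $M\subset\mathbb{R}^3$ be open and $Q$-periodic with $\overline{M\cap Q}\subset Q$. For $G\in\mathbb{R}^{3\times3}$ let $\operatorname{sym}G=\frac12(G^\top+G)$, and let $|\cdot|$ denote Euclidean norms. Let $f:\mathbb{R}^3\times\mathbb{R}^{3\times3}\times\mathbb{R}^3\to\mathbb{R}\cup\{+\infty\}$ and $C>0$ satisfy, for all $z,G,B,G_0,B_0,G_1,B_1$: (f0) $z\mapsto f(z,G,B)$ is $Q$-periodic and (Lebesgue) measurable; (f1) if $z\notin M$, then $f(z,G,B)=f(z,\operatorname{sym}G,B)$ and $\frac1C(|\operatorname{sym}G|^2+|B|^2)-C\le f(z,G,B)\le C(|\operatorname{sym}G|^2+|B|^2)+C$; (f2) if $z\in M$, then $\frac1C|B|^2\le f(z,G,B)\le C(|G|^2+|B|^2)+C$ when $\operatorname{sym}G=0$, and $f(z,G,B)=+\infty$ when $\operatorname{sym}G\ne0$; (f3) if $z\notin M$, then $|f(z,G_0,B_0)-f(z,G_1,B_1)|\le C(|G_0|+|G_1|+|B_0|+|B_1|)(|G_0-G_1|+|B_0-B_1|)$. Define the homogenized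 density by the multi-cell formula $$f_{hom}(G,B)=\inf_{k,\varphi,\beta}\int_Q f\big(kz,\,G+\nabla\varphi(z),\,B+\beta(z)\big)\,dz,$$ where the infimum is over all integers $k\ge1$, all $\varphi\in W^{1,2}_0(Q;\mathbb{R}^3)$ and all $Q$-periodic $\beta\in L^2_{loc}(\mathbb{R}^3;\mathbb{R}^3)$ with $\int_Q\beta\,dz=0$ and $\operatorname{div}\beta=0$ on $\mathbb{R}^3$ in the sense of distributions, for which the integrand is Lebesgue measurable on $Q$ (so that the integral is defined in $\mathbb{R}\cup\{+\infty\}$). Then $f_{hom}$ is finite-valued. It has quadratic growth: there is $K>0$ such that for all $G\in\mathbb{R}^{3\times3}$ and $B\in\mathbb{R}^3$ $$\tfrac1K(|\operatorname{sym}G|^2+|B|^2)-K\le f_{hom}(G,B)\le K(|G|^2+|B|^2)+K.$$ Moreover, $f_{hom}$ is continuous, and there is $L>0$ such that for all $G_0,G_1\in\mathbb{R}^{3\times3}$ and $B_0,B_1\in\mathbb{R}^3$ $$|f_{hom}(G_0,B_0)-f_{hom}(G_1,B_1)|\le L(1+|G_0|+|G_1|+|B_0|+|B_1|)(|G_0-G_1|+|B_0-B_1|).$$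 -/

import Mathlib

open MeasureTheory Filter Topology
open scoped ENNReal ContDiff Matrix Matrix.Norms.Frobenius

noncomputable section

namespace MagnetoHom

/-- Points of `ℝ³` and magnetic inductions, with the Euclidean norm. -/
abbrev R3 : Type := EuclideanSpace ℝ (Fin 3)

/-- Real `3 × 3` matrices; `‖G‖` is the Euclidean (Frobenius) norm. -/
abbrev Mat3 : Type := Matrix (Fin 3) (Fin 3) ℝ

/-- The open unit cube `(0,1)³`. -/
def unitCube : Set R3 := {z | ∀ i, 0 < z i ∧ z i < 1}

/-- The standard basis vector `eᵢ`. -/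
def stdVec (i : Fin 3) : R3 := EuclideanSpace.single i 1

/-- The symmetric part of a matrix. -/
def symPart (G : Mat3) : Mat3 := (1 / 2 : ℝ) • (Gᵀ + G)

/-- The set of rigid inclusions: open, periodic with respect to the unit cube, and well contained
in the cell, i.e. the closure of its part in the open unit cube stays in that cube. -/
structure IsInclusionSet (M : Set R3) : Prop where
  isOpen : IsOpen M
  periodic : ∀ (i : Fin 3) (z : R3), z + stdVec i ∈ M ↔ z ∈ M
  wellContained : closure (M ∩ unitCube) ⊆ unitCube

/-- The assumptions on the energy density `f : ℝ³ × ℝ³ˣ³ × ℝ³ → ℝ ∪ {+∞}` with inclusions `M` and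
constant `C`. Outside of `M` the density is real-valued by the two growth bounds, so that
`EReal.toReal` in the field `lipschitz` is its value. -/
structure IsEnergyDensity (M : Set R3) (C : ℝ) (f : R3 → Mat3 → R3 → EReal) : Prop where
  /-- The values lie in `ℝ ∪ {+∞}`. -/
  ne_bot : ∀ z G B, f z G B ≠ ⊥
  periodic : ∀ (i : Fin 3) (z : R3) (G : Mat3) (B : R3), f (z + stdVec i) G B = f z G B
  /-- Lebesgue measurability in `z` (Borel measurability up to a null set). -/
  measurable : ∀ (G : Mat3) (B : R3), AEMeasurable (fun z => f z G B) volume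
  soft_sym : ∀ z ∉ M, ∀ (G : Mat3) (B : R3), f z G B = f z (symPart G) B
  soft_lower : ∀ z ∉ M, ∀ (G : Mat3) (B : R3),
    ((1 / C * (‖symPart G‖ ^ 2 + ‖B‖ ^ 2) - C : ℝ) : EReal) ≤ f z G B
  soft_upper : ∀ z ∉ M, ∀ (G : Mat3) (B : R3),
    f z G B ≤ ((C * (‖symPart G‖ ^ 2 + ‖B‖ ^ 2) + C : ℝ) : EReal)
  rigid_lower : ∀ z ∈ M, ∀ (G : Mat3) (B : R3), symPart G = 0 →
    ((1 / C * ‖B‖ ^ 2 : ℝ) : EReal) ≤ f z G B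
  rigid_upper : ∀ z ∈ M, ∀ (G : Mat3) (B : R3), symPart G = 0 →
    f z G B ≤ ((C * (‖G‖ ^ 2 + ‖B‖ ^ 2) + C : ℝ) : EReal)
  rigid_top : ∀ z ∈ M, ∀ (G : Mat3) (B : R3), symPart G ≠ 0 → f z G B = ⊤
  lipschitz : ∀ z ∉ M, ∀ (G₀ G₁ : Mat3) (B₀ B₁ : R3),
    |(f z G₀ B₀).toReal - (f z G₁ B₁).toReal|
      ≤ C * (‖G₀‖ + ‖G₁‖ + ‖B₀‖ + ‖B₁‖) * (‖G₀ - G₁‖ + ‖B₀ - B₁‖)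

/-- The classical gradient `(∇ψ)ᵢⱼ = ∂ⱼψᵢ` of a vector field. -/
def gradMat (ψ : R3 → R3) (z : R3) : Mat3 :=
  Matrix.of fun i j => (fderiv ℝ ψ z (stdVec j)) i

/-- `IsW012 φ D`: `φ ∈ W₀^{1,2}(Q; ℝ³)` with weak gradient `D`, where `Q` is the unit cube.
The space is the closure of `C_c^∞(Q; ℝ³)` in the norm of `W^{1,2}(Q; ℝ³)`: there are test fields
`ψₙ` with `ψₙ → φ` and `∇ψₙ → D` in `L²(Q)` (this forces `D` to be the weak gradient of `φ`).
Square integrability and convergence of matrix fields are written entrywise. -/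
structure IsW012 (φ : R3 → R3) (D : R3 → Mat3) : Prop where
  memLp : MemLp φ 2 (volume.restrict unitCube)
  memLp_grad : ∀ i j, MemLp (fun z => D z i j) 2 (volume.restrict unitCube)
  approx : ∃ ψ : ℕ → R3 → R3,
    (∀ n, ContDiff ℝ ∞ (ψ n) ∧ HasCompactSupport (ψ n) ∧ tsupport (ψ n) ⊆ unitCube) ∧
    Tendsto (fun n => eLpNorm (fun z => ψ n z - φ z) 2 (volume.restrict unitCube)) atTop (𝓝 0) ∧
    ∀ i j, Tendsto
      (fun n => eLpNorm (fun z => gradMat (ψ n) z i j - D z i j) 2 (volume.restrict unitCube))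
      atTop (𝓝 0)

/-- `β ∈ L²_per(ℝ³; ℝ³)` with mean zero over the unit cube and `div β = 0` on `ℝ³` in the sense of
distributions. -/
structure IsPerDivFree (β : R3 → R3) : Prop where
  memLp : MemLp β 2 (volume.restrict unitCube)
  periodic : ∀ i : Fin 3, ∀ᵐ z ∂(volume : Measure R3), β (z + stdVec i) = β z
  mean_zero : ∫ z in unitCube, β z = 0
  div_free : ∀ η : R3 → ℝ, ContDiff ℝ ∞ η → HasCompactSupport η →
    ∫ z, fderiv ℝ η z (β z) = 0

/-- Integral over the unit cube of a measurable extended-real function, as the difference of the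
integrals of its positive and negative part. It is only used for integrands that are bounded from
below, so that the second integral is finite. -/
def cubeIntegral (g : R3 → EReal) : EReal :=
  ((∫⁻ z in unitCube, (g z).toENNReal : ℝ≥0∞) : EReal)
    - ((∫⁻ z in unitCube, (-g z).toENNReal : ℝ≥0∞) : EReal)

/-- The integrand `z ↦ f(kz, G + ∇φ(z), B + β(z))` of the multi-cell formula, where `D = ∇φ`. -/
def cellIntegrand (f : R3 → Mat3 → R3 → EReal) (G : Mat3) (B : R3) (k : ℕ)
    (D : R3 → Mat3) (β : R3 → R3) (z : R3) : EReal :=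
  f ((k : ℝ) • z) (G + D z) (B + β z)

/-- The homogenized density, given by the multi-cell formula: the infimum of
`∫_Q f(kz, G + ∇φ(z), B + β(z)) dz` over the integers `k ≥ 1`, the fields `φ ∈ W₀^{1,2}(Q; ℝ³)` and
the periodic divergence-free mean-zero fields `β`, for which the integral is meaningful, i.e. the
integrand is Lebesgue measurable on `Q`. -/
def fhom (f : R3 → Mat3 → R3 → EReal) (G : Mat3) (B : R3) : EReal :=
  sInf {I : EReal | ∃ (k : ℕ) (φ : R3 → R3) (D : R3 → Mat3) (β : R3 → R3),
    1 ≤ k ∧ IsW012 φ D ∧ IsPerDivFree β ∧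
    AEMeasurable (cellIntegrand f G B k D β) (volume.restrict unitCube) ∧
    I = cubeIntegral (cellIntegrand f G B k D β)}

end MagnetoHom

end

noncomputable section

namespace MagnetoHom

/-! ### The unit cube and the integer lattice -/

lemma isOpen_unitCube : IsOpen unitCube := by
  have : unitCube = ⋂ i, {z : R3 | 0 < z i} ∩ {z : R3 | z i < 1} := by
    ext z; simp [unitCube]
  rw [this]
  refine isOpen_iInter_of_finite fun i => ?_
  exact (isOpen_lt (by fun_prop) (by fun_prop)).inter (isOpen_lt (by fun_prop) (by fun_prop))

lemma measurableSet_unitCube : MeasurableSet unitCube := isOpen_unitCube.measurableSet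

lemma unitCube_eq_preimage :
    unitCube = (WithLp.ofLp : R3 → Fin 3 → ℝ) ⁻¹' Set.pi Set.univ fun _ => Set.Ioo 0 1 := by
  ext z; simp [unitCube, Set.mem_pi]

lemma volume_unitCube : volume unitCube = 1 := by
  have h := (EuclideanSpace.volume_preserving_symm_measurableEquiv_toLp (Fin 3)).measure_preimage
    (MeasurableSet.univ_pi fun _ => measurableSet_Ioo (a := (0 : ℝ)) (b := 1)).nullMeasurableSet
  rw [unitCube_eq_preimage]
  exact h.trans (by simp [Real.volume_pi_Ioo])

instance : IsProbabilityMeasure (volume.restrict unitCube) :=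
  ⟨by rw [Measure.restrict_apply_univ, volume_unitCube]⟩

lemma isBounded_unitCube : Bornology.IsBounded unitCube := by
  refine (Metric.isBounded_closedBall (x := (0 : R3)) (r := 2)).subset fun z hz => ?_
  rw [mem_closedBall_zero_iff, EuclideanSpace.norm_eq]
  refine Real.sqrt_le_iff.2 ⟨by norm_num, ?_⟩
  have h : ∀ i, ‖z i‖ ^ 2 ≤ 1 := fun i => by
    rw [Real.norm_eq_abs, sq_abs]; nlinarith [(hz i).1, (hz i).2]
  calc ∑ i, ‖z i‖ ^ 2 ≤ ∑ _i : Fin 3, (1 : ℝ) := Finset.sum_le_sum fun i _ => h i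
    _ ≤ 2 ^ 2 := by norm_num

lemma hasCompactSupport_of_tsupport_subset {E : Type*} [Zero E] {u : R3 → E}
    (h : tsupport u ⊆ unitCube) : HasCompactSupport u :=
  Metric.isCompact_of_isClosed_isBounded (isClosed_tsupport u) (isBounded_unitCube.subset h)

/-- The integer vector `n` as a point of `ℝ³`. -/
def latticePt (n : Fin 3 → ℤ) : R3 := WithLp.toLp 2 fun i => (n i : ℝ)

/-- The cell index of a point. -/
def cellIdx (w : R3) : Fin 3 → ℤ := fun i => ⌊w i⌋

/-- The representative of a point in the half-open unit cell. -/
def fracPt (w : R3) : R3 := WithLp.toLp 2 fun i => Int.fract (w i)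

@[simp] lemma latticePt_apply (n : Fin 3 → ℤ) (i : Fin 3) : latticePt n i = n i := rfl

@[simp] lemma fracPt_apply (w : R3) (i : Fin 3) : fracPt w i = Int.fract (w i) := rfl

@[simp] lemma stdVec_apply (i j : Fin 3) : stdVec i j = if j = i then 1 else 0 := by
  simp [stdVec]

lemma sub_latticePt_cellIdx (w : R3) : w - latticePt (cellIdx w) = fracPt w := by
  ext i; simp [cellIdx]

lemma cellIdx_eq_of_sub_mem {w : R3} {n : Fin 3 → ℤ} (h : w - latticePt n ∈ unitCube) :
    cellIdx w = n := by
  funext i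
  have := h i
  simp only [PiLp.sub_apply, latticePt_apply] at this
  exact Int.floor_eq_iff.2 ⟨by linarith [this.1], by linarith [this.2]⟩

lemma measurable_fracPt : Measurable fracPt := by
  refine (WithLp.measurable_toLp 2 (Fin 3 → ℝ)).comp (measurable_pi_lambda _ fun i => ?_)
  exact measurable_fract.comp (by fun_prop)

lemma fracPt_add_stdVec_smul (w : R3) (k : ℕ) (i : Fin 3) :
    fracPt (w + (k : ℝ) • stdVec i) = fracPt w := by
  ext j
  by_cases h : j = i <;> simp [h]

/-- A field vanishing outside of the unit cube, extended periodically, is a sum of translates. -/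
lemma comp_fracPt_eq_sum {E : Type*} [AddCommMonoid E] {U : R3 → E}
    (hU : ∀ z ∉ unitCube, U z = 0) {w : R3} {F : Finset (Fin 3 → ℤ)} (hF : cellIdx w ∈ F) :
    U (fracPt w) = ∑ n ∈ F, U (w - latticePt n) := by
  rw [← sub_latticePt_cellIdx, Finset.sum_eq_single_of_mem _ hF]
  intro n _ hn
  exact hU _ fun h => hn (cellIdx_eq_of_sub_mem h).symm

/-- The indices of the cells that make up the cube `(0,k)³`. -/
def cubeIdx (k : ℕ) : Finset (Fin 3 → ℤ) := Fintype.piFinset fun _ => Finset.Ico 0 (k : ℤ)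

lemma cellIdx_mem_cubeIdx {k : ℕ} (hk : 1 ≤ k) {z : R3} (hz : z ∈ unitCube) :
    cellIdx ((k : ℝ) • z) ∈ cubeIdx k := by
  have hk' : (0 : ℝ) < k := by exact_mod_cast hk
  refine Fintype.mem_piFinset.2 fun i => Finset.mem_Ico.2 ⟨?_, ?_⟩
  · exact Int.floor_nonneg.2 (mul_nonneg hk'.le (hz i).1.le)
  · refine Int.floor_lt.2 ?_
    have := (hz i).2
    simp only [PiLp.smul_apply, smul_eq_mul, Int.cast_natCast]
    nlinarith

lemma mem_unitCube_of_cubeIdx {k : ℕ} (hk : 1 ≤ k) {z : R3} {n : Fin 3 → ℤ} (hn : n ∈ cubeIdx k)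
    (hz : (k : ℝ) • z - latticePt n ∈ unitCube) : z ∈ unitCube := by
  intro i
  have hk' : (0 : ℝ) < k := by exact_mod_cast hk
  have h := hz i
  obtain ⟨h0, h1⟩ := Finset.mem_Ico.1 (Fintype.mem_piFinset.1 hn i)
  have h0' : (0 : ℝ) ≤ n i := by exact_mod_cast h0
  have h1' : (n i : ℝ) + 1 ≤ k := by exact_mod_cast h1
  simp only [PiLp.sub_apply, PiLp.smul_apply, smul_eq_mul, latticePt_apply] at h
  constructor
  · by_contra hc
    nlinarith [h.1]
  · by_contra hc
    nlinarith [h.2]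

lemma fracPt_mem_closure_unitCube (w : R3) : fracPt w ∈ closure unitCube := by
  let c : R3 := WithLp.toLp 2 fun _ => (1 / 2 : ℝ)
  have hlim : Tendsto (fun t : ℝ => fracPt w + t • (c - fracPt w)) (𝓝[>] 0) (𝓝 (fracPt w)) := by
    have : Continuous fun t : ℝ => fracPt w + t • (c - fracPt w) := by fun_prop
    simpa using (this.tendsto 0).mono_left nhdsWithin_le_nhds
  refine mem_closure_of_tendsto hlim ?_
  filter_upwards [Ioo_mem_nhdsGT (zero_lt_one' ℝ)] with t ht i
  have h0 := Int.fract_nonneg (w i)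
  have h1 := Int.fract_lt_one (w i)
  simp only [PiLp.add_apply, PiLp.smul_apply, PiLp.sub_apply, fracPt_apply, smul_eq_mul, c]
  constructor <;> nlinarith [ht.1, ht.2]

lemma IsInclusionSet.sub_latticePt_mem {M : Set R3} (hM : IsInclusionSet M) (n : Fin 3 → ℤ)
    {w : R3} (hw : w ∈ M) : w - latticePt n ∈ M := by
  have hper : ∀ i, Function.Periodic (fun z => z ∈ M) (stdVec i) := fun i z =>
    propext (hM.periodic i z)
  have hn : w - latticePt n
      = w + (-n 0) • stdVec 0 + (-n 1) • stdVec 1 + (-n 2) • stdVec 2 := by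
    ext i; fin_cases i <;> simp [sub_eq_add_neg]
  rw [hn]
  have h0 := ((hper 0).zsmul (-n 0)) w
  have h1 := ((hper 1).zsmul (-n 1)) (w + (-n 0) • stdVec 0)
  have h2 := ((hper 2).zsmul (-n 2)) (w + (-n 0) • stdVec 0 + (-n 1) • stdVec 1)
  exact (h2.trans (h1.trans h0)).mpr hw

/-- Inclusions do not touch the cell boundaries. -/
lemma IsInclusionSet.fracPt_mem {M : Set R3} (hM : IsInclusionSet M) {w : R3} (hw : w ∈ M) :
    fracPt w ∈ M ∩ unitCube := by
  have h : fracPt w ∈ M := by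
    rw [← sub_latticePt_cellIdx]; exact hM.sub_latticePt_mem _ hw
  exact ⟨h, hM.wellContained
    (hM.isOpen.inter_closure ⟨h, fracPt_mem_closure_unitCube w⟩)⟩

/-! ### Gradients of smooth fields -/

lemma gradMat_eq_zero_of_notMem_tsupport {g : R3 → R3} {z : R3} (h : z ∉ tsupport g) :
    gradMat g z = 0 := by
  have : fderiv ℝ g z = 0 := by
    by_contra hc
    exact h (support_fderiv_subset ℝ hc)
  ext i j; simp [gradMat, this]

lemma continuous_gradMat_apply {g : R3 → R3} (hg : ContDiff ℝ ∞ g) (i j : Fin 3) :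
    Continuous fun z => gradMat g z i j := by
  have : Continuous (fderiv ℝ g) := hg.continuous_fderiv (by simp)
  have h2 : Continuous fun z => fderiv ℝ g z (stdVec j) := by fun_prop
  exact (EuclideanSpace.proj (𝕜 := ℝ) i).continuous.comp h2

lemma gradMat_apply {g : R3 → R3} (hg : Differentiable ℝ g) (z : R3) (i j : Fin 3) :
    gradMat g z i j = fderiv ℝ (fun y => g y i) z (stdVec j) := by
  have := ((EuclideanSpace.proj (𝕜 := ℝ) i).hasFDerivAt.comp z (hg z).hasFDerivAt).fderiv
  have h2 : (⇑(EuclideanSpace.proj (𝕜 := ℝ) i) ∘ g) = fun y => g y i := rfl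
  rw [h2] at this
  rw [this]; rfl

lemma gradMat_add {u v : R3 → R3} (hu : Differentiable ℝ u) (hv : Differentiable ℝ v) (z : R3) :
    gradMat (fun y => u y + v y) z = gradMat u z + gradMat v z := by
  ext i j
  simp [gradMat, fderiv_fun_add (hu z) (hv z)]

lemma gradMat_sum {ι : Type*} (F : Finset ι) {u : ι → R3 → R3}
    (hu : ∀ n ∈ F, Differentiable ℝ (u n)) (z : R3) :
    gradMat (fun y => ∑ n ∈ F, u n y) z = ∑ n ∈ F, gradMat (u n) z := by
  ext i j
  simp [gradMat, fderiv_fun_sum (fun n hn => hu n hn z), Matrix.sum_apply]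

/-- The field `z ↦ H g(kz - n) / k`, which has the gradient `H ∇g(kz - n)`. -/
def rescale (g : R3 → R3) (k : ℕ) (H : Mat3) (n : Fin 3 → ℤ) (z : R3) : R3 :=
  (k : ℝ)⁻¹ • Matrix.toEuclideanCLM (𝕜 := ℝ) H (g ((k : ℝ) • z - latticePt n))

lemma contDiff_rescale {g : R3 → R3} (hg : ContDiff ℝ ∞ g) (k : ℕ) (H : Mat3) (n : Fin 3 → ℤ) :
    ContDiff ℝ ∞ (rescale g k H n) := by
  unfold rescale; fun_prop

lemma gradMat_rescale {g : R3 → R3} (hg : ContDiff ℝ ∞ g) {k : ℕ} (hk : 1 ≤ k) (H : Mat3)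
    (n : Fin 3 → ℤ) (z : R3) :
    gradMat (rescale g k H n) z = H * gradMat g ((k : ℝ) • z - latticePt n) := by
  have hk' : (k : ℝ) ≠ 0 := by positivity
  have hd : HasFDerivAt (fun z : R3 => (k : ℝ) • z - latticePt n)
      ((k : ℝ) • ContinuousLinearMap.id ℝ R3) z :=
    ((hasFDerivAt_id z).const_smul (k : ℝ)).sub_const _
  have hg' := (hg.differentiable (by simp) ((k : ℝ) • z - latticePt n)).hasFDerivAt
  have h := (((Matrix.toEuclideanCLM (𝕜 := ℝ) H).hasFDerivAt.comp z
    (hg'.comp z hd)).const_smul (k : ℝ)⁻¹).fderiv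
  have h2 : fderiv ℝ (rescale g k H n) z = _ := h
  ext i j
  simp only [gradMat, h2, Matrix.of_apply, Matrix.mul_apply]
  simp [hk', Matrix.ofLp_toEuclideanCLM, Matrix.mulVec, dotProduct]

lemma tsupport_rescale_subset {g : R3 → R3} (hg : tsupport g ⊆ unitCube) {k : ℕ} (hk : 1 ≤ k)
    (H : Mat3) {n : Fin 3 → ℤ} (hn : n ∈ cubeIdx k) :
    tsupport (rescale g k H n) ⊆ unitCube := by
  have hcl : IsClosed ((fun z : R3 => (k : ℝ) • z - latticePt n) ⁻¹' tsupport g) :=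
    (isClosed_tsupport g).preimage (by fun_prop)
  have : tsupport (rescale g k H n) ⊆ (fun z : R3 => (k : ℝ) • z - latticePt n) ⁻¹' tsupport g := by
    refine closure_minimal (fun z hz => subset_tsupport g fun h0 => hz ?_) hcl
    simp [rescale, h0]
  exact fun z hz => mem_unitCube_of_cubeIdx hk hn (hg (this hz))

/-- Every open set whose closure stays in the cube carries a compactly supported smooth field that
is the identity there, up to second order. -/
lemma exists_cutoff_identity {S : Set R3} (hS : IsOpen S) (hcl : closure S ⊆ unitCube) :
    ∃ g : R3 → R3, ContDiff ℝ ∞ g ∧ tsupport g ⊆ unitCube ∧ ∀ z ∈ S, gradMat g z = 1 := by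
  have hK : IsCompact (closure S) :=
    Metric.isCompact_of_isClosed_isBounded isClosed_closure (isBounded_unitCube.subset hcl)
  obtain ⟨T, hT, hST, hTQ⟩ := exists_compact_between hK isOpen_unitCube hcl
  obtain ⟨χ, h1, h0, -⟩ := exists_contMDiffMap_one_nhds_of_subset_interior
    (n := (⊤ : ℕ∞)) (modelWithCornersSelf ℝ R3) isClosed_closure hST
  have hχ : ContDiff ℝ ∞ χ := χ.contMDiff.contDiff
  refine ⟨fun z => χ z • z, by fun_prop, ?_, fun z hz => ?_⟩
  · refine (closure_minimal (fun z hz => ?_) hT.isClosed).trans hTQ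
    by_contra hc
    exact hz (by simp [h0 z hc])
  · have : (fun z => χ z • z) =ᶠ[𝓝 z] id := by
      filter_upwards [hS.mem_nhds hz] with y hy
      simp [h1.self_of_nhdsSet y (subset_closure hy)]
    ext i j
    simp [gradMat, this.fderiv_eq, Matrix.one_apply]

/-! ### Integration by parts -/

lemma integral_fderiv_eq_zero {u : R3 → ℝ} (hu : ContDiff ℝ ∞ u) (hc : HasCompactSupport u)
    (a : R3) : ∫ z, fderiv ℝ u z a = 0 := by
  have hd : Continuous fun z => fderiv ℝ u z a :=
    (hu.continuous_fderiv (by simp)).clm_apply continuous_const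
  have := integral_mul_fderiv_eq_neg_fderiv_mul_of_integrable (μ := (volume : Measure R3))
    (f := fun _ => (1 : ℝ)) (g := u) (v := a) (by simp)
    (by simpa using hd.integrable_of_hasCompactSupport (hc.fderiv_apply (𝕜 := ℝ) a))
    (by simpa using hu.continuous.integrable_of_hasCompactSupport hc)
    (by fun_prop) (fun x _ => hu.differentiable (by simp) x)
  simpa using this

lemma integral_fderiv_mul_fderiv_comm {η u : R3 → ℝ} (hη : ContDiff ℝ ∞ η) (hu : ContDiff ℝ ∞ u)
    (hc : HasCompactSupport u) (a b : R3) :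
    ∫ z, fderiv ℝ η z a * fderiv ℝ u z b = ∫ z, fderiv ℝ η z b * fderiv ℝ u z a := by
  have hη' : ∀ a, ContDiff ℝ ∞ fun z => fderiv ℝ η z a := fun a =>
    (hη.fderiv_right (m := ∞) (by simp)).clm_apply contDiff_const
  have hu' : ∀ a, Continuous fun z => fderiv ℝ u z a := fun a =>
    (hu.continuous_fderiv (by simp)).clm_apply continuous_const
  have hη'' : ∀ a b, Continuous fun z => fderiv ℝ (fun y => fderiv ℝ η y a) z b := fun a b =>
    ((hη' a).continuous_fderiv (by simp)).clm_apply continuous_const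
  have key : ∀ a b, ∫ z, fderiv ℝ η z a * fderiv ℝ u z b
      = -∫ z, fderiv ℝ (fun y => fderiv ℝ η y a) z b * u z := fun a b =>
    integral_mul_fderiv_eq_neg_fderiv_mul_of_integrable
      (((hη'' a b).mul hu.continuous).integrable_of_hasCompactSupport hc.mul_left)
      (((hη' a).continuous.mul (hu' b)).integrable_of_hasCompactSupport
        (hc.fderiv_apply (𝕜 := ℝ) b).mul_left)
      (((hη' a).continuous.mul hu.continuous).integrable_of_hasCompactSupport hc.mul_left)
      (fun x _ => (hη' a).differentiable (by simp) x)
      (fun x _ => hu.differentiable (by simp) x)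
  rw [key a b, key b a]
  congr 2
  funext z
  have hsymm := (hη.contDiffAt (x := z)).isSymmSndFDerivAt
    (by simpa using (WithTop.coe_le_coe.2 le_top : ((2 : ℕ∞) : WithTop ℕ∞) ≤ ((⊤ : ℕ∞) : WithTop ℕ∞)))
  have hdd : DifferentiableAt ℝ (fderiv ℝ η) z :=
    (hη.fderiv_right (m := ∞) (by simp)).differentiable (by simp) z
  have hap : ∀ a b, fderiv ℝ (fun y => fderiv ℝ η y a) z b = fderiv ℝ (fderiv ℝ η) z b a := by
    intro a b
    rw [fderiv_clm_apply hdd (by fun_prop)]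
    simp
  rw [hap, hap, hsymm.eq]

/-! ### Periodic correctors -/

lemma abs_apply_le_norm (A : Mat3) (i j : Fin 3) : |A i j| ≤ ‖A‖ := by
  rw [Matrix.frobenius_norm_def, ← Real.sqrt_eq_rpow, ← Real.norm_eq_abs]
  refine Real.le_sqrt_of_sq_le ?_
  simp only [Real.rpow_two]
  calc ‖A i j‖ ^ 2 ≤ ∑ j, ‖A i j‖ ^ 2 :=
        Finset.single_le_sum (f := fun j => ‖A i j‖ ^ 2) (fun _ _ => sq_nonneg _)
          (Finset.mem_univ j)
    _ ≤ ∑ i, ∑ j, ‖A i j‖ ^ 2 :=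
        Finset.single_le_sum (f := fun i => ∑ j, ‖A i j‖ ^ 2)
          (fun _ _ => Finset.sum_nonneg fun _ _ => sq_nonneg _) (Finset.mem_univ i)

lemma abs_coord_le_norm (v : R3) (i : Fin 3) : |v i| ≤ ‖v‖ := PiLp.norm_apply_le v i

lemma norm_le_sum_abs (v : R3) : ‖v‖ ≤ ∑ i, |v i| := by
  have h : v = ∑ i, v i • stdVec i := by
    ext j; simp [Finset.sum_apply]
  calc ‖v‖ = ‖∑ i, v i • stdVec i‖ := by rw [← h]
    _ ≤ ∑ i, ‖v i • stdVec i‖ := norm_sum_le _ _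
    _ = ∑ i, |v i| := by simp [norm_smul, stdVec]

lemma clm_apply_eq_sum (L : R3 →L[ℝ] ℝ) (v : R3) : L v = ∑ i, v i * L (stdVec i) := by
  have h : v = ∑ i, v i • stdVec i := by
    ext j; simp [Finset.sum_apply]
  conv_lhs => rw [h]
  simp

/-- `½((tr A) b - A b)`; for `A = ∇g` this field is divergence-free, and for `A = 1` it is `b`. -/
def solenoidal (b : R3) (A : Mat3) : R3 :=
  WithLp.toLp 2 fun i => ∑ l, (1 / 2 : ℝ) * (A l l * b i - A i l * b l)

lemma solenoidal_apply (b : R3) (A : Mat3) (i : Fin 3) :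
    solenoidal b A i = ∑ l, (1 / 2 : ℝ) * (A l l * b i - A i l * b l) := rfl

lemma solenoidal_one (b : R3) : solenoidal b 1 = b := by
  ext i
  fin_cases i <;> simp [solenoidal_apply, Fin.sum_univ_three] <;> ring

lemma solenoidal_zero (b : R3) : solenoidal b 0 = 0 := by
  ext i; simp [solenoidal_apply]

lemma norm_solenoidal_le (b : R3) (A : Mat3) : ‖solenoidal b A‖ ≤ 9 * ‖A‖ * ‖b‖ := by
  have h : ∀ i, |solenoidal b A i| ≤ 3 * ‖A‖ * ‖b‖ := fun i => by
    rw [solenoidal_apply]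
    refine (Finset.abs_sum_le_sum_abs _ _).trans ?_
    have hl : ∀ l, |(1 / 2 : ℝ) * (A l l * b i - A i l * b l)| ≤ ‖A‖ * ‖b‖ := fun l => by
      have h1 : |A l l * b i| ≤ ‖A‖ * ‖b‖ := by
        rw [abs_mul]
        exact mul_le_mul (abs_apply_le_norm A l l) (abs_coord_le_norm b i) (abs_nonneg _)
          (norm_nonneg _)
      have h2 : |A i l * b l| ≤ ‖A‖ * ‖b‖ := by
        rw [abs_mul]
        exact mul_le_mul (abs_apply_le_norm A i l) (abs_coord_le_norm b l) (abs_nonneg _)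
          (norm_nonneg _)
      rw [abs_mul, abs_of_pos (by norm_num : (0 : ℝ) < 1 / 2)]
      linarith [abs_sub (A l l * b i) (A i l * b l)]
    calc ∑ l, |(1 / 2 : ℝ) * (A l l * b i - A i l * b l)| ≤ ∑ _l : Fin 3, ‖A‖ * ‖b‖ :=
          Finset.sum_le_sum fun l _ => hl l
      _ = 3 * ‖A‖ * ‖b‖ := by simp; ring
  calc ‖solenoidal b A‖ ≤ ∑ i, |solenoidal b A i| := norm_le_sum_abs _
    _ ≤ ∑ _i : Fin 3, 3 * ‖A‖ * ‖b‖ := Finset.sum_le_sum fun i _ => h i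
    _ = 9 * ‖A‖ * ‖b‖ := by simp; ring

/-- The gradient corrector `H ∇g` and its periodic oscillation. -/
def gradCorr (g : R3 → R3) (k : ℕ) (H : Mat3) (z : R3) : Mat3 :=
  H * gradMat g (fracPt ((k : ℝ) • z))

/-- The divergence-free corrector and its periodic oscillation. -/
def divCorr (g : R3 → R3) (k : ℕ) (b : R3) (z : R3) : R3 :=
  solenoidal b (gradMat g (fracPt ((k : ℝ) • z)))

lemma continuous_gradMat {g : R3 → R3} (hg : ContDiff ℝ ∞ g) : Continuous (gradMat g) :=
  continuous_matrix fun i j => continuous_gradMat_apply hg i j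

lemma exists_norm_gradMat_le {g : R3 → R3} (hg : ContDiff ℝ ∞ g) (hs : tsupport g ⊆ unitCube) :
    ∃ c : ℝ, 0 ≤ c ∧ ∀ z, ‖gradMat g z‖ ≤ c := by
  have hc : HasCompactSupport (gradMat g) :=
    (hasCompactSupport_of_tsupport_subset hs).mono' fun z hz => by
      by_contra h
      exact hz (gradMat_eq_zero_of_notMem_tsupport h)
  obtain ⟨c, hcb⟩ := hc.exists_bound_of_continuous (continuous_gradMat hg)
  exact ⟨c, (norm_nonneg _).trans (hcb 0), hcb⟩

lemma measurable_gradMat_fracPt {g : R3 → R3} (hg : ContDiff ℝ ∞ g) (k : ℕ) (i j : Fin 3) :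
    Measurable fun z => gradMat g (fracPt ((k : ℝ) • z)) i j :=
  (continuous_gradMat_apply hg i j).measurable.comp
    (measurable_fracPt.comp (measurable_const_smul (k : ℝ)))

lemma measurable_gradCorr {g : R3 → R3} (hg : ContDiff ℝ ∞ g) (k : ℕ) (H : Mat3) (i j : Fin 3) :
    Measurable fun z => gradCorr g k H z i j := by
  simp only [gradCorr, Matrix.mul_apply]
  exact Finset.measurable_sum _ fun l _ => (measurable_gradMat_fracPt hg k l j).const_mul _

lemma measurable_divCorr {g : R3 → R3} (hg : ContDiff ℝ ∞ g) (k : ℕ) (b : R3) :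
    Measurable (divCorr g k b) := by
  refine (WithLp.measurable_toLp 2 (Fin 3 → ℝ)).comp (measurable_pi_lambda _ fun i => ?_)
  refine Finset.measurable_sum _ fun l _ => ?_
  exact (((measurable_gradMat_fracPt hg k l l).mul_const _).sub
    ((measurable_gradMat_fracPt hg k i l).mul_const _)).const_mul _

lemma hasCompactSupport_rescale {g : R3 → R3} (hg : HasCompactSupport g) {k : ℕ} (hk : 1 ≤ k)
    (H : Mat3) (n : Fin 3 → ℤ) : HasCompactSupport (rescale g k H n) := by
  have hk' : (k : ℝ) ≠ 0 := by positivity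
  have h := hg.comp_homeomorph
    ((Homeomorph.smulOfNeZero (k : ℝ) hk').trans (Homeomorph.subRight (latticePt n)))
  refine h.mono fun z hz h0 => hz ?_
  have h0' : g ((k : ℝ) • z - latticePt n) = 0 := h0
  simp [rescale, h0']

lemma gradMat_eq_zero_of_notMem {g : R3 → R3} (hs : tsupport g ⊆ unitCube) (z : R3)
    (hz : z ∉ unitCube) : gradMat g z = 0 :=
  gradMat_eq_zero_of_notMem_tsupport fun h => hz (hs h)

lemma gradCorr_eq_sum {g : R3 → R3} (hg : ContDiff ℝ ∞ g) (hs : tsupport g ⊆ unitCube) {k : ℕ}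
    (hk : 1 ≤ k) (H : Mat3) {z : R3} {F : Finset (Fin 3 → ℤ)} (hF : cellIdx ((k : ℝ) • z) ∈ F) :
    gradCorr g k H z = ∑ n ∈ F, gradMat (rescale g k H n) z := by
  simp only [gradMat_rescale hg hk]
  exact comp_fracPt_eq_sum (U := fun w => H * gradMat g w)
    (fun w hw => by simp [gradMat_eq_zero_of_notMem hs w hw]) hF

lemma divCorr_eq_sum {g : R3 → R3} (hg : ContDiff ℝ ∞ g) (hs : tsupport g ⊆ unitCube) {k : ℕ}
    (hk : 1 ≤ k) (b : R3) {z : R3} {F : Finset (Fin 3 → ℤ)} (hF : cellIdx ((k : ℝ) • z) ∈ F) :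
    divCorr g k b z = ∑ n ∈ F, solenoidal b (gradMat (rescale g k 1 n) z) := by
  simp only [gradMat_rescale hg hk, one_mul]
  exact comp_fracPt_eq_sum (U := fun w => solenoidal b (gradMat g w))
    (fun w hw => by simp [gradMat_eq_zero_of_notMem hs w hw, solenoidal_zero]) hF

lemma integral_gradMat_eq_zero {u : R3 → R3} (hu : ContDiff ℝ ∞ u) (hc : HasCompactSupport u)
    (i j : Fin 3) : ∫ z, gradMat u z i j = 0 := by
  simp only [gradMat_apply (hu.differentiable (by simp))]
  refine integral_fderiv_eq_zero (by fun_prop) (hc.comp_left (g := fun v : R3 => v i) rfl) _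

lemma hasCompactSupport_gradMat_apply {u : R3 → R3} (hc : HasCompactSupport u)
    (i j : Fin 3) : HasCompactSupport fun z => gradMat u z i j :=
  hc.mono' fun z hz => by
    by_contra h
    exact hz (by simp [gradMat_eq_zero_of_notMem_tsupport h])

lemma integrable_gradMat_apply {u : R3 → R3} (hu : ContDiff ℝ ∞ u) (hc : HasCompactSupport u)
    (i j : Fin 3) : Integrable fun z => gradMat u z i j :=
  (continuous_gradMat_apply hu i j).integrable_of_hasCompactSupport
    (hasCompactSupport_gradMat_apply hc i j)

lemma setIntegral_gradMat_eq_zero {u : R3 → R3} (hu : ContDiff ℝ ∞ u) (hs : tsupport u ⊆ unitCube)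
    (i j : Fin 3) : ∫ z in unitCube, gradMat u z i j = 0 := by
  rw [setIntegral_eq_integral_of_forall_compl_eq_zero fun z hz => by
    simp [gradMat_eq_zero_of_notMem hs z hz]]
  exact integral_gradMat_eq_zero hu (hasCompactSupport_of_tsupport_subset hs) i j

/-- Solenoidal fields have zero divergence in the sense of distributions. -/
lemma integral_fderiv_solenoidal {η : R3 → ℝ} (hη : ContDiff ℝ ∞ η) {u : R3 → R3}
    (hu : ContDiff ℝ ∞ u) (hc : HasCompactSupport u) (b : R3) :
    Integrable (fun z => fderiv ℝ η z (solenoidal b (gradMat u z))) ∧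
      ∫ z, fderiv ℝ η z (solenoidal b (gradMat u z)) = 0 := by
  let p : Fin 3 → Fin 3 → Fin 3 → R3 → ℝ := fun i l j z =>
    fderiv ℝ η z (stdVec i) * gradMat u z l j
  have hη' : ∀ i, Continuous fun z => fderiv ℝ η z (stdVec i) := fun i =>
    (hη.continuous_fderiv (by simp)).clm_apply continuous_const
  have hp : ∀ i l j, Integrable (p i l j) := fun i l j =>
    ((hη' i).mul (continuous_gradMat_apply hu l j)).integrable_of_hasCompactSupport
      (hasCompactSupport_gradMat_apply hc l j).mul_left
  have hsymm : ∀ i l j, ∫ z, p i l j z = ∫ z, p j l i z := fun i l j => by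
    simp only [p, gradMat_apply (hu.differentiable (by simp))]
    exact integral_fderiv_mul_fderiv_comm hη (by fun_prop)
      (hc.comp_left (g := fun v : R3 => v l) rfl) _ _
  have heq : (fun z => fderiv ℝ η z (solenoidal b (gradMat u z)))
      = fun z => ∑ i, ∑ l, (b i / 2 * p i l l z - b l / 2 * p i i l z) := by
    funext z
    rw [clm_apply_eq_sum]
    refine Finset.sum_congr rfl fun i _ => ?_
    rw [solenoidal_apply, Finset.sum_mul]
    refine Finset.sum_congr rfl fun l _ => ?_
    simp only [p]; ring
  have hint : ∀ i l, Integrable fun z => b i / 2 * p i l l z - b l / 2 * p i i l z := fun i l =>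
    ((hp i l l).const_mul _).sub ((hp i i l).const_mul _)
  rw [heq]
  refine ⟨integrable_finsetSum _ fun i _ => integrable_finsetSum _ fun l _ => hint i l, ?_⟩
  rw [integral_finsetSum _ fun i _ => integrable_finsetSum _ fun l _ => hint i l]
  simp_rw [integral_finsetSum _ fun l _ => hint _ l]
  have hterm : ∀ i l, ∫ z, (b i / 2 * p i l l z - b l / 2 * p i i l z)
      = b i / 2 * (∫ z, p i l l z) - b l / 2 * ∫ z, p l i i z := fun i l => by
    rw [integral_sub ((hp i l l).const_mul _) ((hp i i l).const_mul _), integral_const_mul,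
      integral_const_mul, hsymm i i l]
  simp_rw [hterm, Finset.sum_sub_distrib]
  rw [sub_eq_zero, Finset.sum_comm]

/-- The cells that meet a bounded set are finitely many. -/
lemma exists_finset_cellIdx {S : Set R3} (hS : Bornology.IsBounded S) (k : ℕ) :
    ∃ F : Finset (Fin 3 → ℤ), ∀ z ∈ S, cellIdx ((k : ℝ) • z) ∈ F := by
  obtain ⟨R, hR⟩ := hS.exists_norm_le
  refine ⟨Fintype.piFinset fun _ => Finset.Icc ⌊-(k * R)⌋ ⌊k * R⌋, fun z hz => ?_⟩
  refine Fintype.mem_piFinset.2 fun i => Finset.mem_Icc.2 ?_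
  have h1 := abs_le.1 ((abs_coord_le_norm z i).trans (hR z hz))
  have hk : (0 : ℝ) ≤ k := k.cast_nonneg
  have e : ((k : ℝ) • z) i = k * z i := rfl
  exact ⟨Int.floor_le_floor (by rw [e]; nlinarith [h1.1]),
    Int.floor_le_floor (by rw [e]; nlinarith [h1.2])⟩

lemma IsPerDivFree.add_divCorr {β : R3 → R3} (hβ : IsPerDivFree β) {g : R3 → R3}
    (hg : ContDiff ℝ ∞ g) (hs : tsupport g ⊆ unitCube) {k : ℕ} (hk : 1 ≤ k) (b : R3) :
    IsPerDivFree fun z => β z + divCorr g k b z := by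
  obtain ⟨c, hc0, hc⟩ := exists_norm_gradMat_le hg hs
  have hgc := hasCompactSupport_of_tsupport_subset hs
  have hmem : MemLp (divCorr g k b) 2 (volume.restrict unitCube) := by
    refine MemLp.of_bound (measurable_divCorr hg k b).aestronglyMeasurable (9 * c * ‖b‖)
      (.of_forall fun z => (norm_solenoidal_le _ _).trans ?_)
    gcongr
    exact hc _
  refine ⟨hβ.memLp.add hmem, fun i => ?_, ?_, fun η hη hηc => ?_⟩
  · filter_upwards [hβ.periodic i] with z hz
    rw [hz, divCorr, divCorr, smul_add, fracPt_add_stdVec_smul]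
  · rw [integral_add (hβ.memLp.integrable one_le_two) (hmem.integrable one_le_two), hβ.mean_zero,
      zero_add]
    have hsupp : ∀ n ∈ cubeIdx k, tsupport (rescale g k 1 n) ⊆ unitCube := fun n hn =>
      tsupport_rescale_subset hs hk 1 hn
    have hint : ∀ n i j, Integrable (fun z => gradMat (rescale g k 1 n) z i j)
        (volume.restrict unitCube) := fun n i j =>
      (integrable_gradMat_apply (contDiff_rescale hg k 1 n)
        (hasCompactSupport_rescale hgc hk 1 n) i j).restrict
    have hcoord : ∀ i, ∫ z in unitCube, divCorr g k b z i = 0 := fun i => by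
      have : ∀ z ∈ unitCube, divCorr g k b z i = ∑ n ∈ cubeIdx k, ∑ l, (1 / 2 : ℝ) *
          (gradMat (rescale g k 1 n) z l l * b i - gradMat (rescale g k 1 n) z i l * b l) := by
        intro z hz
        rw [divCorr_eq_sum hg hs hk b (cellIdx_mem_cubeIdx hk hz)]
        simp [solenoidal_apply]
      have hterm : ∀ n l, Integrable (fun z => (1 / 2 : ℝ) *
          (gradMat (rescale g k 1 n) z l l * b i - gradMat (rescale g k 1 n) z i l * b l))
          (volume.restrict unitCube) := fun n l =>
        (((hint n l l).mul_const _).sub ((hint n i l).mul_const _)).const_mul _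
      rw [setIntegral_congr_fun measurableSet_unitCube this,
        integral_finsetSum _ fun n _ => integrable_finsetSum _ fun l _ => hterm n l]
      refine Finset.sum_eq_zero fun n hn => ?_
      rw [integral_finsetSum _ fun l _ => hterm n l]
      refine Finset.sum_eq_zero fun l _ => ?_
      rw [integral_const_mul, integral_sub ((hint n l l).mul_const _) ((hint n i l).mul_const _),
        integral_mul_const, integral_mul_const,
        setIntegral_gradMat_eq_zero (contDiff_rescale hg k 1 n) (hsupp n hn),
        setIntegral_gradMat_eq_zero (contDiff_rescale hg k 1 n) (hsupp n hn)]
      simp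
    ext i
    have := (EuclideanSpace.proj (𝕜 := ℝ) i).integral_comp_comm (hmem.integrable one_le_two)
    exact this.symm.trans (hcoord i)
  · obtain ⟨F, hF⟩ := exists_finset_cellIdx (S := tsupport η) hηc.isCompact.isBounded k
    have heq : (fun z => fderiv ℝ η z (divCorr g k b z))
        = fun z => ∑ n ∈ F, fderiv ℝ η z (solenoidal b (gradMat (rescale g k 1 n) z)) := by
      funext z
      by_cases hz : z ∈ tsupport η
      · rw [divCorr_eq_sum hg hs hk b (hF z hz), map_sum]
      · have : fderiv ℝ η z = 0 := by
          by_contra h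
          exact hz (support_fderiv_subset ℝ h)
        simp [this]
    have hn := fun n => integral_fderiv_solenoidal hη (contDiff_rescale hg k 1 n)
      (hasCompactSupport_rescale hgc hk 1 n) b
    have hi : Integrable fun z => fderiv ℝ η z (divCorr g k b z) := by
      rw [heq]; exact integrable_finsetSum _ fun n _ => (hn n).1
    have h0 : ∫ z, fderiv ℝ η z (divCorr g k b z) = 0 := by
      rw [heq, integral_finsetSum _ fun n _ => (hn n).1]
      exact Finset.sum_eq_zero fun n _ => (hn n).2
    simp only [map_add]
    by_cases hβi : Integrable fun z => fderiv ℝ η z (β z)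
    · rw [integral_add hβi hi, h0, hβ.div_free η hη hηc, add_zero]
    · exact integral_undef fun h => hβi ((integrable_add_iff_integrable_left hi).1 h)

lemma IsW012.add_gradCorr {φ : R3 → R3} {D : R3 → Mat3} (hφ : IsW012 φ D) {g : R3 → R3}
    (hg : ContDiff ℝ ∞ g) (hs : tsupport g ⊆ unitCube) {k : ℕ} (hk : 1 ≤ k) (H : Mat3) :
    IsW012 (fun z => φ z + ∑ n ∈ cubeIdx k, rescale g k H n z)
      fun z => D z + gradCorr g k H z := by
  obtain ⟨c, hc0, hc⟩ := exists_norm_gradMat_le hg hs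
  obtain ⟨ψ, hψ, hψφ, hψD⟩ := hφ.approx
  set θ : R3 → R3 := fun z => ∑ n ∈ cubeIdx k, rescale g k H n z with hθ
  have hθc : ContDiff ℝ ∞ θ := ContDiff.sum fun n _ => contDiff_rescale hg k H n
  have hθs : tsupport θ ⊆ unitCube := by
    have hcl : IsClosed (⋃ n ∈ cubeIdx k, tsupport (rescale g k H n)) :=
      (cubeIdx k).finite_toSet.isClosed_biUnion fun n _ => isClosed_tsupport _
    refine (closure_minimal (fun z hz => ?_) hcl).trans
      (Set.iUnion₂_subset fun n hn => tsupport_rescale_subset hs hk H hn)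
    by_contra h
    simp only [Set.mem_iUnion, not_exists] at h
    exact hz (Finset.sum_eq_zero fun n hn => image_eq_zero_of_notMem_tsupport (h n hn))
  have hθg : ∀ z ∈ unitCube, gradMat θ z = gradCorr g k H z := fun z hz => by
    rw [gradCorr_eq_sum hg hs hk H (cellIdx_mem_cubeIdx hk hz), hθ,
      gradMat_sum _ fun n _ => (contDiff_rescale hg k H n).differentiable (by simp)]
  have hadd : ∀ n z, gradMat (fun y => ψ n y + θ y) z = gradMat (ψ n) z + gradMat θ z :=
    fun n z => gradMat_add ((hψ n).1.differentiable (by simp)) (hθc.differentiable (by simp)) z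
  refine ⟨hφ.memLp.add ?_, fun i j => (hφ.memLp_grad i j).add ?_, fun n z => ψ n z + θ z,
    fun n => ?_, ?_, fun i j => ?_⟩
  · exact (hθc.continuous.memLp_of_hasCompactSupport
      (hasCompactSupport_of_tsupport_subset hθs)).restrict _
  · refine MemLp.of_bound (measurable_gradCorr hg k H i j).aestronglyMeasurable (‖H‖ * c)
      (.of_forall fun z => (abs_apply_le_norm _ i j).trans ?_)
    refine (norm_mul_le _ _).trans ?_
    gcongr
    exact hc _
  · have hsub : tsupport (fun z => ψ n z + θ z) ⊆ unitCube :=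
      (tsupport_add (ψ n) θ).trans (Set.union_subset (hψ n).2.2 hθs)
    exact ⟨(hψ n).1.add hθc, hasCompactSupport_of_tsupport_subset hsub, hsub⟩
  · simpa only [hθ, add_sub_add_right_eq_sub] using hψφ
  · refine (hψD i j).congr fun n => eLpNorm_congr_ae ?_
    filter_upwards [ae_restrict_mem measurableSet_unitCube] with z hz
    rw [hadd, hθg z hz]
    simp

/-! ### Extended-real integrals over the cube -/

lemma cubeIntegral_eq_coe {g : R3 → EReal} {r : R3 → ℝ}
    (hr : Integrable r (volume.restrict unitCube))
    (hg : ∀ᵐ z ∂volume.restrict unitCube, g z = (r z : EReal)) :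
    cubeIntegral g = ((∫ z in unitCube, r z : ℝ) : EReal) := by
  have h1 : ∫⁻ z in unitCube, (g z).toENNReal = ∫⁻ z in unitCube, ENNReal.ofReal (r z) :=
    lintegral_congr_ae (by filter_upwards [hg] with z hz; rw [hz, EReal.toENNReal_of_ne_top] <;> simp)
  have h2 : ∫⁻ z in unitCube, (-g z).toENNReal = ∫⁻ z in unitCube, ENNReal.ofReal (-r z) :=
    lintegral_congr_ae (by
      filter_upwards [hg] with z hz
      rw [hz, ← EReal.coe_neg, EReal.toENNReal_of_ne_top] <;> simp)
  rw [cubeIntegral, h1, h2, integral_eq_lintegral_pos_part_sub_lintegral_neg_part hr,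
    EReal.coe_sub, EReal.coe_ennreal_toReal, EReal.coe_ennreal_toReal]
  · exact hr.neg.lintegral_lt_top.ne
  · exact hr.lintegral_lt_top.ne

lemma integrable_toReal_of_cubeIntegral_ne_top {g : R3 → EReal} {C : ℝ}
    (hg : AEMeasurable g (volume.restrict unitCube)) (hb : ∀ z, ((-C : ℝ) : EReal) ≤ g z)
    (ht : cubeIntegral g ≠ ⊤) :
    Integrable (fun z => (g z).toReal) (volume.restrict unitCube) ∧
      ∀ᵐ z ∂volume.restrict unitCube, g z = ((g z).toReal : EReal) := by
  have hneg : ∫⁻ z in unitCube, (-g z).toENNReal ≠ ⊤ := by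
    have h : ∫⁻ z in unitCube, (-g z).toENNReal ≤ ∫⁻ z in unitCube, ENNReal.ofReal C := by
      refine lintegral_mono fun z => ?_
      have h1 : -g z ≤ ((C : ℝ) : EReal) := by
        have := EReal.neg_le_neg_iff.2 (hb z)
        simpa using this
      simpa using EReal.toENNReal_le_toENNReal h1
    refine ne_top_of_le_ne_top ?_ h
    simp
  have hpos : ∫⁻ z in unitCube, (g z).toENNReal ≠ ⊤ := by
    intro h
    apply ht
    rw [cubeIntegral, h]
    lift (∫⁻ z in unitCube, (-g z).toENNReal) to NNReal using hneg with y
    exact EReal.top_sub_coe y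
  have hm : AEMeasurable (fun z => (g z).toENNReal) (volume.restrict unitCube) :=
    EReal.continuous_toENNReal.measurable.comp_aemeasurable hg
  have hfin : ∀ᵐ z ∂volume.restrict unitCube, g z = ((g z).toReal : EReal) := by
    filter_upwards [ae_lt_top' hm hpos] with z hz
    refine (EReal.coe_toReal (fun h => ?_) (fun h => ?_)).symm
    · simp [h] at hz
    · have := hb z
      rw [h] at this
      exact absurd this (by simp)
  refine ⟨⟨(measurable_ereal_toReal.comp_aemeasurable hg).aestronglyMeasurable, ?_⟩, hfin⟩
  have hle : ∫⁻ z in unitCube, ‖(g z).toReal‖ₑ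
      ≤ ∫⁻ z in unitCube, ((g z).toENNReal + (-g z).toENNReal) := by
    refine lintegral_mono_ae ?_
    filter_upwards [hfin] with z hz
    generalize (g z).toReal = r at hz
    rw [hz, ← EReal.coe_neg, EReal.toENNReal_of_ne_top (by simp),
      EReal.toENNReal_of_ne_top (by simp), Real.enorm_eq_ofReal_abs]
    simp only [EReal.toReal_coe]
    rcases le_total 0 r with h | h
    · rw [abs_of_nonneg h]; exact le_self_add
    · rw [abs_of_nonpos h]; exact le_add_self
  refine hle.trans_lt ?_
  rw [lintegral_add_left' hm]
  exact ENNReal.add_lt_top.2 ⟨hpos.lt_top, hneg.lt_top⟩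

/-- Composition of a Carathéodory function with a measurable map. -/
lemma aemeasurable_caratheodory {α P : Type*} [MeasurableSpace α] {μ : Measure α}
    [TopologicalSpace P] [TopologicalSpace.MetrizableSpace P] [MeasurableSpace P]
    [SecondCountableTopology P] [OpensMeasurableSpace P] [MeasurableSpace.CountablyGenerated P]
    {F : α → P → ℝ} (hc : ∀ z, Continuous (F z)) (hm : ∀ p, AEMeasurable (fun z => F z p) μ)
    {u : α → P} (hu : AEMeasurable u μ) : AEMeasurable (fun z => F z (u z)) μ := by
  have h : @Measurable (P × NullMeasurableSpace α μ) ℝ _ _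
      (Function.uncurry fun (p : P) (z : NullMeasurableSpace α μ) => F z p) :=
    measurable_uncurry_of_continuous_of_measurable (fun z => hc z) fun p => (hm p).nullMeasurable
  have hu' : @Measurable (NullMeasurableSpace α μ) P _ _ u := hu.nullMeasurable
  have h2 : @Measurable (NullMeasurableSpace α μ) (P × NullMeasurableSpace α μ) _ _
      (fun z => (u z, z)) := hu'.prodMk measurable_id
  have h3 : NullMeasurable (fun z => F z (u z)) μ := h.comp h2
  exact h3.aemeasurable

lemma aemeasurable_ite {α β : Type*} [MeasurableSpace α] [MeasurableSpace β] {μ : Measure α}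
    {p : α → Prop} [DecidablePred p] (hp : MeasurableSet {z | p z}) {u v : α → β}
    (hu : AEMeasurable u μ) (hv : AEMeasurable v μ) :
    AEMeasurable (fun z => if p z then u z else v z) μ := by
  refine ⟨fun z => if p z then hu.mk u z else hv.mk v z,
    Measurable.ite hp hu.measurable_mk hv.measurable_mk, ?_⟩
  filter_upwards [hu.ae_eq_mk, hv.ae_eq_mk] with z h1 h2
  rw [h1, h2]

/-! ### Symmetric parts -/

lemma norm_sq_eq_sum (A : Mat3) : ‖A‖ ^ 2 = ∑ i, ∑ j, A i j ^ 2 := by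
  rw [Matrix.frobenius_norm_def, ← Real.sqrt_eq_rpow, Real.sq_sqrt
    (Finset.sum_nonneg fun _ _ => Finset.sum_nonneg fun _ _ => by positivity)]
  simp

lemma symPart_sub (A B : Mat3) : symPart (A - B) = symPart A - symPart B := by
  simp only [symPart, Matrix.transpose_sub, ← smul_sub]
  congr 1; abel

lemma symPart_apply (A : Mat3) (i j : Fin 3) : symPart A i j = (A j i + A i j) / 2 := by
  simp [symPart]; ring

lemma norm_symPart_le (A : Mat3) : ‖symPart A‖ ≤ ‖A‖ := by
  have h1 : ‖symPart A‖ = 1 / 2 * ‖Aᵀ + A‖ := by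
    rw [symPart, norm_smul]; norm_num
  have h2 := norm_add_le Aᵀ A
  rw [Matrix.frobenius_norm_transpose] at h2
  rw [h1]; linarith

lemma symPart_zero : symPart 0 = 0 := by simp [symPart]

/-! ### Bounds on the energy density -/

section

variable {M : Set R3} {C : ℝ} {f : R3 → Mat3 → R3 → EReal}

lemma IsEnergyDensity.lower (hf : IsEnergyDensity M C f) (hC : 0 < C) (z : R3) (G : Mat3)
    (B : R3) : ((1 / C * (‖symPart G‖ ^ 2 + ‖B‖ ^ 2) - C : ℝ) : EReal) ≤ f z G B := by
  by_cases hz : z ∈ M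
  · by_cases hG : symPart G = 0
    · refine le_trans ?_ (hf.rigid_lower z hz G B hG)
      rw [EReal.coe_le_coe_iff, hG]
      simp only [norm_zero]
      linarith
    · rw [hf.rigid_top z hz G B hG]; exact le_top
  · exact hf.soft_lower z hz G B

lemma IsEnergyDensity.neg_le (hf : IsEnergyDensity M C f) (hC : 0 < C) (z : R3) (G : Mat3)
    (B : R3) : ((-C : ℝ) : EReal) ≤ f z G B := by
  refine le_trans ?_ (hf.lower hC z G B)
  rw [EReal.coe_le_coe_iff]
  have : 0 ≤ 1 / C * (‖symPart G‖ ^ 2 + ‖B‖ ^ 2) := by positivity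
  linarith

lemma IsEnergyDensity.coe_toReal (hf : IsEnergyDensity M C f) {z : R3} (hz : z ∉ M) (G : Mat3)
    (B : R3) : f z G B = ((f z G B).toReal : EReal) :=
  (EReal.coe_toReal (ne_top_of_le_ne_top (EReal.coe_ne_top _) (hf.soft_upper z hz G B))
    (hf.ne_bot z G B)).symm

lemma IsEnergyDensity.abs_sub_le (hf : IsEnergyDensity M C f) {z : R3} (hz : z ∉ M)
    (G₀ G₁ : Mat3) (B₀ B₁ : R3) :
    |(f z G₁ B₁).toReal - (f z G₀ B₀).toReal|
      ≤ C * (‖symPart G₀‖ + ‖symPart G₁‖ + ‖B₀‖ + ‖B₁‖) *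
        (‖symPart G₀ - symPart G₁‖ + ‖B₀ - B₁‖) := by
  rw [hf.soft_sym z hz G₀, hf.soft_sym z hz G₁, abs_sub_comm]
  exact hf.lipschitz z hz _ _ _ _

lemma continuous_of_lipschitz_of_linear_growth {h : Mat3 → R3 → ℝ} {c L : ℝ}
    (hL : ∀ (G₀ G₁ : Mat3) (B₀ B₁ : R3), |h G₀ B₀ - h G₁ B₁|
      ≤ L * (c + ‖G₀‖ + ‖G₁‖ + ‖B₀‖ + ‖B₁‖) * (‖G₀ - G₁‖ + ‖B₀ - B₁‖)) :
    Continuous fun p : Mat3 × R3 => h p.1 p.2 := by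
  refine continuous_iff_continuousAt.2 fun p => ?_
  refine tendsto_iff_norm_sub_tendsto_zero.2 ?_
  refine squeeze_zero (fun _ => norm_nonneg _) (fun q => hL q.1 p.1 q.2 p.2) ?_
  have hcont : Continuous fun q : Mat3 × R3 =>
      L * (c + ‖q.1‖ + ‖p.1‖ + ‖q.2‖ + ‖p.2‖) * (‖q.1 - p.1‖ + ‖q.2 - p.2‖) := by fun_prop
  simpa using hcont.tendsto p

lemma IsEnergyDensity.aemeasurable_scaled (hf : IsEnergyDensity M C f) {k : ℕ} (hk : 1 ≤ k)
    (G : Mat3) (B : R3) : AEMeasurable (fun z => f ((k : ℝ) • z) G B) volume := by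
  have hk' : (k : ℝ) ≠ 0 := by positivity
  refine (hf.measurable G B).comp_quasiMeasurePreserving ⟨measurable_const_smul (k : ℝ), ?_⟩
  rw [Measure.map_addHaar_smul volume hk']
  exact Measure.smul_absolutelyContinuous

/-- Replacing the fields off the inclusions preserves measurability of the integrand. -/
lemma IsEnergyDensity.aemeasurable_of_eq_on (hf : IsEnergyDensity M C f) (hM : MeasurableSet M)
    {k : ℕ} (hk : 1 ≤ k) {μ : Measure R3} (hμ : μ ≪ volume) {g : R3 → EReal}
    (hg : AEMeasurable g μ) {A : R3 → Mat3} (hA : ∀ i j, AEMeasurable (fun z => A z i j) μ)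
    {v : R3 → R3} (hv : AEMeasurable v μ)
    (heq : ∀ z, (k : ℝ) • z ∈ M → f ((k : ℝ) • z) (A z) (v z) = g z) :
    AEMeasurable (fun z => f ((k : ℝ) • z) (A z) (v z)) μ := by
  classical
  have hMk : MeasurableSet {z : R3 | (k : ℝ) • z ∈ M} := measurable_const_smul (k : ℝ) hM
  let F : R3 → (Fin 3 → Fin 3 → ℝ) × R3 → ℝ := fun z p =>
    if (k : ℝ) • z ∈ M then 0 else (f ((k : ℝ) • z) (Matrix.of p.1) p.2).toReal
  have hF : AEMeasurable (fun z => F z (fun i j => A z i j, v z)) μ := by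
    refine aemeasurable_caratheodory (fun z => ?_) (fun p => ?_)
      (AEMeasurable.prodMk (aemeasurable_pi_lambda _ fun i => aemeasurable_pi_lambda _ fun j =>
        hA i j) hv)
    · by_cases hz : (k : ℝ) • z ∈ M
      · simp only [F, hz, if_true]; exact continuous_const
      · simp only [F, hz, if_false]
        have h := continuous_of_lipschitz_of_linear_growth (c := 0) (L := C)
          (h := fun G B => (f ((k : ℝ) • z) G B).toReal)
          (fun G₀ G₁ B₀ B₁ => by simpa using hf.lipschitz _ hz G₀ G₁ B₀ B₁)
        have h2 : Continuous fun p : (Fin 3 → Fin 3 → ℝ) × R3 => ((Matrix.of p.1 : Mat3), p.2) :=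
          continuous_id
        exact h.comp h2
    · have h := (measurable_ereal_toReal.comp_aemeasurable
        ((hf.aemeasurable_scaled hk (Matrix.of p.1) p.2).mono_ac hμ))
      exact aemeasurable_ite hMk aemeasurable_const h
  have heq' : (fun z => f ((k : ℝ) • z) (A z) (v z)) = fun z =>
      if (k : ℝ) • z ∈ M then g z else ((F z (fun i j => A z i j, v z) : ℝ) : EReal) := by
    funext z
    by_cases hz : (k : ℝ) • z ∈ M
    · simp [hz, heq z hz]
    · simp only [F, hz, if_false]
      exact hf.coe_toReal hz _ _
  rw [heq']
  exact aemeasurable_ite hMk hg (measurable_coe_real_ereal.comp_aemeasurable hF)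

end

/-! ### Comparison of the homogenized density at two arguments -/

section

variable {M : Set R3} {C : ℝ} {f : R3 → Mat3 → R3 → EReal}

/-- A competitor for `(G₀, B₀)` of energy `E` can be corrected to a competitor for `(G₁, B₁)`. -/
lemma exists_fhom_le (hM : IsInclusionSet M) (hC : 0 < C) (hf : IsEnergyDensity M C f) :
    ∃ c : ℝ, 0 < c ∧ ∀ (G₀ : Mat3) (B₀ : R3) (k : ℕ) (φ : R3 → R3) (D : R3 → Mat3) (β : R3 → R3),
      1 ≤ k → IsW012 φ D → IsPerDivFree β →
      AEMeasurable (cellIntegrand f G₀ B₀ k D β) (volume.restrict unitCube) →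
      ∀ E : ℝ, cubeIntegral (cellIntegrand f G₀ B₀ k D β) = (E : EReal) →
      ∀ s : ℝ, 0 < s → 2 * C * (E + C) ≤ s ^ 2 → ∀ (G₁ : Mat3) (B₁ : R3),
        fhom f G₁ B₁ ≤ ((E + c * (s + (‖G₀ - G₁‖ + ‖B₀ - B₁‖)) * (‖G₀ - G₁‖ + ‖B₀ - B₁‖) : ℝ)
          : EReal) := by
  obtain ⟨g, hg, hs, hone⟩ := exists_cutoff_identity
    (hM.isOpen.inter isOpen_unitCube) hM.wellContained
  obtain ⟨c₀, hc₀, hgb⟩ := exists_norm_gradMat_le hg hs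
  set c₁ : ℝ := 1 + 9 * c₀ with hc₁
  have hc₁pos : 0 < c₁ := by positivity
  refine ⟨C * c₁ * (2 + c₁), by positivity, ?_⟩
  intro G₀ B₀ k φ D β hk hφ hβ hmeas E hE s hs0 hsE G₁ B₁
  set Δ : ℝ := ‖G₀ - G₁‖ + ‖B₀ - B₁‖ with hΔ
  have hΔ0 : 0 ≤ Δ := by positivity
  set D' : R3 → Mat3 := fun z => D z + gradCorr g k (G₀ - G₁) z with hD'
  set β' : R3 → R3 := fun z => β z + divCorr g k (B₀ - B₁) z with hβ'
  have hW := hφ.add_gradCorr hg hs hk (G₀ - G₁)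
  have hP := hβ.add_divCorr hg hs hk (B₀ - B₁)
  have hrigid : ∀ z, (k : ℝ) • z ∈ M →
      cellIntegrand f G₁ B₁ k D' β' z = cellIntegrand f G₀ B₀ k D β z := by
    intro z hz
    have h1 := hone _ (hM.fracPt_mem hz)
    have e1 : G₁ + D' z = G₀ + D z := by
      simp only [hD', gradCorr, h1, mul_one]; abel
    have e2 : B₁ + β' z = B₀ + β z := by
      simp only [hβ', divCorr, h1, solenoidal_one]; abel
    rw [cellIntegrand, cellIntegrand, e1, e2]
  have hmeas' : AEMeasurable (cellIntegrand f G₁ B₁ k D' β') (volume.restrict unitCube) := by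
    refine hf.aemeasurable_of_eq_on hM.isOpen.measurableSet hk
      Measure.absolutelyContinuous_restrict hmeas (A := fun z => G₁ + D' z)
      (v := fun z => B₁ + β' z) (fun i j => ?_) ?_ hrigid
    · exact (hW.memLp_grad i j).aestronglyMeasurable.aemeasurable.const_add (G₁ i j)
    · exact hP.memLp.aestronglyMeasurable.aemeasurable.const_add B₁
  set r : R3 → ℝ := fun z => (cellIntegrand f G₀ B₀ k D β z).toReal with hr
  set r' : R3 → ℝ := fun z => (cellIntegrand f G₁ B₁ k D' β' z).toReal with hr'
  obtain ⟨hri, hrc⟩ := integrable_toReal_of_cubeIntegral_ne_top (C := C) hmeas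
    (fun z => hf.neg_le hC _ _ _) (by rw [hE]; exact EReal.coe_ne_top _)
  have hrE : ∫ z in unitCube, r z = E := by
    have := cubeIntegral_eq_coe hri hrc
    rw [hE] at this
    exact (EReal.coe_eq_coe_iff.1 this).symm
  have hrc' : ∀ᵐ z ∂volume.restrict unitCube,
      cellIntegrand f G₁ B₁ k D' β' z = (r' z : EReal) := by
    filter_upwards [hrc] with z hz
    by_cases hzM : (k : ℝ) • z ∈ M
    · simp only [hr', hrigid z hzM]; exact hz
    · exact hf.coe_toReal hzM _ _
  set a : ℝ := C * (c₁ * Δ) with ha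
  have ha0 : 0 ≤ a := by positivity
  set ψ : ℝ → ℝ := fun t => a * (2 * C / s) * t + a * (2 * C ^ 2 / s + s + c₁ * Δ) with hψ
  have hdiff : ∀ᵐ z ∂volume.restrict unitCube, |r' z - r z| ≤ ψ (r z) := by
    filter_upwards [hrc] with z hz
    set S₀ := symPart (G₀ + D z) with hS₀
    set b₀ := B₀ + β z with hb₀
    have hlow : 1 / C * (‖S₀‖ ^ 2 + ‖b₀‖ ^ 2) - C ≤ r z := by
      have := hf.lower hC ((k : ℝ) • z) (G₀ + D z) (B₀ + β z)
      rw [show f ((k : ℝ) • z) (G₀ + D z) (B₀ + β z) = ((r z : ℝ) : EReal) from hz] at this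
      exact EReal.coe_le_coe_iff.1 this
    have hlow' : ‖S₀‖ ^ 2 + ‖b₀‖ ^ 2 ≤ C * (r z + C) := by
      have h2 : 1 / C * (‖S₀‖ ^ 2 + ‖b₀‖ ^ 2) ≤ r z + C := by linarith
      rw [one_div, inv_mul_le_iff₀ hC] at h2
      exact h2
    have hψ' : ψ (r z) = a * (2 * (C * (r z + C)) / s + s + c₁ * Δ) := by
      simp only [hψ]; field_simp; ring
    have hq : 0 ≤ C * (r z + C) := le_trans (by positivity) hlow'
    by_cases hzM : (k : ℝ) • z ∈ M
    · have : r' z = r z := by simp only [hr, hr', hrigid z hzM]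
      rw [this, sub_self, abs_zero, hψ']
      positivity
    · have hsG : ‖S₀ - symPart (G₁ + D' z)‖ ≤ c₁ * ‖G₀ - G₁‖ := by
        rw [hS₀, ← symPart_sub]
        refine (norm_symPart_le _).trans ?_
        have e : G₀ + D z - (G₁ + D' z) = (G₀ - G₁) - gradCorr g k (G₀ - G₁) z := by
          simp only [hD']; abel
        rw [e]
        have h1 : ‖gradCorr g k (G₀ - G₁) z‖ ≤ ‖G₀ - G₁‖ * c₀ :=
          (norm_mul_le _ _).trans (mul_le_mul_of_nonneg_left (hgb _) (norm_nonneg _))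
        have h2 := norm_sub_le (G₀ - G₁) (gradCorr g k (G₀ - G₁) z)
        have h3 : 0 ≤ c₀ * ‖G₀ - G₁‖ := by positivity
        rw [hc₁]; linarith
      have hsB : ‖b₀ - (B₁ + β' z)‖ ≤ c₁ * ‖B₀ - B₁‖ := by
        have e : b₀ - (B₁ + β' z) = (B₀ - B₁) - divCorr g k (B₀ - B₁) z := by
          simp only [hb₀, hβ']; abel
        rw [e]
        have h1 : ‖divCorr g k (B₀ - B₁) z‖ ≤ 9 * c₀ * ‖B₀ - B₁‖ :=
          (norm_solenoidal_le _ _).trans (by gcongr; exact hgb _)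
        have h2 := norm_sub_le (B₀ - B₁) (divCorr g k (B₀ - B₁) z)
        rw [hc₁]; linarith
      have hsum : ‖S₀ - symPart (G₁ + D' z)‖ + ‖b₀ - (B₁ + β' z)‖ ≤ c₁ * Δ := by
        rw [hΔ]; linarith
      have hS₁ : ‖symPart (G₁ + D' z)‖ ≤ ‖S₀‖ + ‖S₀ - symPart (G₁ + D' z)‖ := by
        have := norm_sub_le S₀ (S₀ - symPart (G₁ + D' z))
        rwa [sub_sub_cancel] at this
      have hb₁ : ‖B₁ + β' z‖ ≤ ‖b₀‖ + ‖b₀ - (B₁ + β' z)‖ := by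
        have := norm_sub_le b₀ (b₀ - (B₁ + β' z))
        rwa [sub_sub_cancel] at this
      have hmain := hf.abs_sub_le hzM (G₀ + D z) (G₁ + D' z) (B₀ + β z) (B₁ + β' z)
      have hfac : ‖S₀‖ + ‖symPart (G₁ + D' z)‖ + ‖b₀‖ + ‖B₁ + β' z‖
          ≤ 2 * (C * (r z + C)) / s + s + c₁ * Δ := by
        have hy : 2 * (‖S₀‖ + ‖b₀‖) ≤ 2 * (C * (r z + C)) / s + s := by
          rw [← sub_le_iff_le_add, le_div_iff₀ hs0]
          nlinarith [sq_nonneg (‖S₀‖ + ‖b₀‖ - s), sq_nonneg (‖S₀‖ - ‖b₀‖)]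
        linarith
      calc |r' z - r z| ≤ C * (‖S₀‖ + ‖symPart (G₁ + D' z)‖ + ‖b₀‖ + ‖B₁ + β' z‖) *
            (‖S₀ - symPart (G₁ + D' z)‖ + ‖b₀ - (B₁ + β' z)‖) := hmain
        _ ≤ C * (2 * (C * (r z + C)) / s + s + c₁ * Δ) * (c₁ * Δ) := by gcongr
        _ = ψ (r z) := by rw [hψ', ha]; ring
  have hψi : Integrable (fun z => ψ (r z)) (volume.restrict unitCube) :=
    (hri.const_mul _).add (integrable_const _)
  have hri' : Integrable r' (volume.restrict unitCube) := by
    refine Integrable.mono' (hri.norm.add hψi)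
      (measurable_ereal_toReal.comp_aemeasurable hmeas').aestronglyMeasurable ?_
    filter_upwards [hdiff] with z hz
    simp only [Real.norm_eq_abs, Pi.add_apply] at hz ⊢
    linarith [abs_sub_abs_le_abs_sub (r' z) (r z)]
  have hle : ∫ z in unitCube, r' z
      ≤ E + (a * (2 * C / s) * E + a * (2 * C ^ 2 / s + s + c₁ * Δ)) := by
    calc ∫ z in unitCube, r' z ≤ ∫ z in unitCube, (r z + ψ (r z)) := by
          refine integral_mono_ae hri' (hri.add hψi) ?_
          filter_upwards [hdiff] with z hz
          have := (abs_le.1 hz).2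
          show r' z ≤ r z + ψ (r z)
          linarith
      _ = E + (a * (2 * C / s) * E + a * (2 * C ^ 2 / s + s + c₁ * Δ)) := by
          rw [integral_add hri hψi, hrE]
          simp only [hψ]
          rw [integral_add (hri.const_mul _) (integrable_const _), integral_const_mul, hrE]
          simp
  have hfin : E + (a * (2 * C / s) * E + a * (2 * C ^ 2 / s + s + c₁ * Δ))
      ≤ E + C * c₁ * (2 + c₁) * (s + Δ) * Δ := by
    have h1 : a * (2 * C / s) * E + a * (2 * C ^ 2 / s + s + c₁ * Δ)
        = a * (2 * C * (E + C) / s + s + c₁ * Δ) := by field_simp; ring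
    have h2 : 2 * C * (E + C) / s ≤ s := by
      rw [div_le_iff₀ hs0]; linarith [hsE]
    have h3 : a * (2 * C * (E + C) / s + s + c₁ * Δ) ≤ a * (2 * s + c₁ * Δ) :=
      mul_le_mul_of_nonneg_left (by linarith) ha0
    have h4 : a * (2 * s + c₁ * Δ) ≤ a * ((2 + c₁) * (s + Δ)) :=
      mul_le_mul_of_nonneg_left (by nlinarith) ha0
    have h5 : a * ((2 + c₁) * (s + Δ)) = C * c₁ * (2 + c₁) * (s + Δ) * Δ := by rw [ha]; ring
    linarith
  refine le_trans (sInf_le ⟨k, _, D', β', hk, hW, hP, hmeas', rfl⟩) ?_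
  rw [cubeIntegral_eq_coe hri' hrc', EReal.coe_le_coe_iff]
  exact hle.trans hfin

/-! ### Lower bound -/

lemma IsW012.integral_grad_eq_zero {φ : R3 → R3} {D : R3 → Mat3} (hφ : IsW012 φ D)
    (i j : Fin 3) : ∫ z in unitCube, D z i j = 0 := by
  obtain ⟨ψ, hψ, -, hψD⟩ := hφ.approx
  have hmeas : ∀ n, AEStronglyMeasurable (fun z => gradMat (ψ n) z i j - D z i j)
      (volume.restrict unitCube) := fun n =>
    (continuous_gradMat_apply (hψ n).1 i j).aestronglyMeasurable.sub
      (hφ.memLp_grad i j).aestronglyMeasurable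
  have hL1 : Tendsto (fun n => eLpNorm (fun z => gradMat (ψ n) z i j - D z i j) 1
      (volume.restrict unitCube)) atTop (𝓝 0) :=
    tendsto_of_tendsto_of_tendsto_of_le_of_le tendsto_const_nhds (hψD i j) (fun _ => zero_le)
      fun n => eLpNorm_le_eLpNorm_of_exponent_le one_le_two (hmeas n)
  have h := tendsto_integral_of_L1' (fun z => D z i j)
    ((hφ.memLp_grad i j).aestronglyMeasurable)
    (F := fun n z => gradMat (ψ n) z i j) (l := atTop)
    (.of_forall fun n => (integrable_gradMat_apply (hψ n).1 (hψ n).2.1 i j).restrict) hL1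
  simp only [setIntegral_gradMat_eq_zero (hψ _).1 (hψ _).2.2] at h
  exact (tendsto_nhds_unique tendsto_const_nhds h).symm

lemma IsEnergyDensity.le_cubeIntegral (hC : 0 < C) (hf : IsEnergyDensity M C f) {G : Mat3} {B : R3}
    {k : ℕ} {φ : R3 → R3} {D : R3 → Mat3} {β : R3 → R3} (hφ : IsW012 φ D) (hβ : IsPerDivFree β)
    (hmeas : AEMeasurable (cellIntegrand f G B k D β) (volume.restrict unitCube)) :
    ((1 / C * (‖symPart G‖ ^ 2 + ‖B‖ ^ 2) - C : ℝ) : EReal)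
      ≤ cubeIntegral (cellIntegrand f G B k D β) := by
  by_cases ht : cubeIntegral (cellIntegrand f G B k D β) = ⊤
  · rw [ht]; exact le_top
  obtain ⟨hri, hrc⟩ := integrable_toReal_of_cubeIntegral_ne_top (C := C) hmeas
    (fun z => hf.neg_le hC _ _ _) ht
  rw [cubeIntegral_eq_coe hri hrc, EReal.coe_le_coe_iff]
  have hDi : ∀ i j, Integrable (fun z => D z i j) (volume.restrict unitCube) := fun i j =>
    (hφ.memLp_grad i j).integrable one_le_two
  have hβi : Integrable β (volume.restrict unitCube) := hβ.memLp.integrable one_le_two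
  let ℓ : R3 → ℝ := fun z => ∑ i, ∑ j, symPart G i j * (D z j i + D z i j)
  let m : R3 → ℝ := fun z => inner ℝ B (β z)
  have hℓt : ∀ i j, Integrable (fun z => symPart G i j * (D z j i + D z i j))
      (volume.restrict unitCube) := fun i j => ((hDi j i).add (hDi i j)).const_mul _
  have hℓi : Integrable ℓ (volume.restrict unitCube) :=
    integrable_finsetSum _ fun i _ => integrable_finsetSum _ fun j _ => hℓt i j
  have hℓ0 : ∫ z in unitCube, ℓ z = 0 := by
    rw [integral_finsetSum _ fun i _ => integrable_finsetSum _ fun j _ => hℓt i j]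
    refine Finset.sum_eq_zero fun i _ => ?_
    rw [integral_finsetSum _ fun j _ => hℓt i j]
    refine Finset.sum_eq_zero fun j _ => ?_
    rw [integral_const_mul, integral_add (hDi j i) (hDi i j), hφ.integral_grad_eq_zero,
      hφ.integral_grad_eq_zero]
    simp
  have hmi : Integrable m (volume.restrict unitCube) := hβi.const_inner B
  have hm0 : ∫ z in unitCube, m z = 0 := by
    rw [integral_inner hβi B, hβ.mean_zero, inner_zero_right]
  have hle : ∀ᵐ z ∂volume.restrict unitCube,
      1 / C * (‖symPart G‖ ^ 2 + ‖B‖ ^ 2 + ℓ z + 2 * m z) - C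
        ≤ (cellIntegrand f G B k D β z).toReal := by
    filter_upwards [hrc] with z hz
    have h1 : 1 / C * (‖symPart (G + D z)‖ ^ 2 + ‖B + β z‖ ^ 2) - C
        ≤ (cellIntegrand f G B k D β z).toReal := by
      have := hf.lower hC ((k : ℝ) • z) (G + D z) (B + β z)
      rw [show f ((k : ℝ) • z) (G + D z) (B + β z) = _ from hz] at this
      exact EReal.coe_le_coe_iff.1 this
    have h2 : ‖B‖ ^ 2 + 2 * m z ≤ ‖B + β z‖ ^ 2 := by
      rw [norm_add_sq_real]; linarith [sq_nonneg ‖β z‖]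
    have h3 : ‖symPart G‖ ^ 2 + ℓ z ≤ ‖symPart (G + D z)‖ ^ 2 := by
      rw [norm_sq_eq_sum, norm_sq_eq_sum, ← Finset.sum_add_distrib]
      refine Finset.sum_le_sum fun i _ => ?_
      rw [← Finset.sum_add_distrib]
      refine Finset.sum_le_sum fun j _ => ?_
      simp only [symPart_apply, Matrix.add_apply]
      nlinarith [sq_nonneg (D z j i + D z i j)]
    refine le_trans ?_ h1
    have hC' : 0 ≤ 1 / C := by positivity
    have := mul_le_mul_of_nonneg_left (add_le_add h3 h2) hC'
    linarith
  have h1 : Integrable (fun z => ‖symPart G‖ ^ 2 + ‖B‖ ^ 2 + ℓ z) (volume.restrict unitCube) :=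
    (integrable_const _).add hℓi
  have h2 : Integrable (fun z => ‖symPart G‖ ^ 2 + ‖B‖ ^ 2 + ℓ z + 2 * m z)
      (volume.restrict unitCube) := h1.add (hmi.const_mul 2)
  have h3 : Integrable (fun z => 1 / C * (‖symPart G‖ ^ 2 + ‖B‖ ^ 2 + ℓ z + 2 * m z))
      (volume.restrict unitCube) := h2.const_mul _
  refine le_trans (le_of_eq ?_) (integral_mono_ae (h3.sub (integrable_const _)) hri hle)
  rw [integral_sub' h3 (integrable_const _), integral_const_mul,
    integral_add h1 (hmi.const_mul 2), integral_add (integrable_const _) hℓi,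
    integral_const_mul, hℓ0, hm0]
  simp

lemma IsEnergyDensity.le_fhom (hC : 0 < C) (hf : IsEnergyDensity M C f) (G : Mat3) (B : R3) :
    ((1 / C * (‖symPart G‖ ^ 2 + ‖B‖ ^ 2) - C : ℝ) : EReal) ≤ fhom f G B := by
  refine le_sInf ?_
  rintro I ⟨k, φ, D, β, -, hφ, hβ, hmeas, rfl⟩
  exact hf.le_cubeIntegral hC hφ hβ hmeas

/-! ### Trivial competitors -/

lemma isW012_zero : IsW012 0 0 := by
  refine ⟨MemLp.zero, fun i j => MemLp.zero, fun _ => 0, fun n => ⟨contDiff_const, .zero, ?_⟩, ?_,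
    fun i j => ?_⟩
  · simp [tsupport]
  · simp
  · simp [gradMat]

lemma isPerDivFree_zero : IsPerDivFree 0 :=
  ⟨MemLp.zero, fun _ => .of_forall fun _ => rfl, by simp, fun _ _ _ => by simp⟩

lemma IsEnergyDensity.exists_trivial_energy (hC : 0 < C) (hf : IsEnergyDensity M C f) (B : R3) :
    ∃ E : ℝ, E ≤ C * ‖B‖ ^ 2 + C ∧
      AEMeasurable (cellIntegrand f 0 B 1 0 0) (volume.restrict unitCube) ∧
      cubeIntegral (cellIntegrand f 0 B 1 0 0) = (E : EReal) := by
  have hcell : ∀ z, cellIntegrand f 0 B 1 0 0 z = f z 0 B := fun z => by simp [cellIntegrand]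
  have hup : ∀ z, f z 0 B ≤ ((C * ‖B‖ ^ 2 + C : ℝ) : EReal) := fun z => by
    by_cases hz : z ∈ M
    · simpa using hf.rigid_upper z hz 0 B symPart_zero
    · simpa [symPart_zero] using hf.soft_upper z hz 0 B
  have hmeas : AEMeasurable (cellIntegrand f 0 B 1 0 0) (volume.restrict unitCube) := by
    simpa only [funext hcell] using (hf.measurable 0 B).restrict
  have hcoe : ∀ z, f z 0 B = ((f z 0 B).toReal : EReal) := fun z =>
    (EReal.coe_toReal (ne_top_of_le_ne_top (EReal.coe_ne_top _) (hup z)) (hf.ne_bot z 0 B)).symm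
  have hlo' : ∀ z, -C ≤ (f z 0 B).toReal := fun z => by
    have := hf.neg_le hC z 0 B
    rw [hcoe z] at this
    exact EReal.coe_le_coe_iff.1 this
  have hup' : ∀ z, (f z 0 B).toReal ≤ C * ‖B‖ ^ 2 + C := fun z => by
    have := hup z
    rw [hcoe z] at this
    exact EReal.coe_le_coe_iff.1 this
  have hint : Integrable (fun z => (f z 0 B).toReal) (volume.restrict unitCube) := by
    refine Integrable.of_bound (measurable_ereal_toReal.comp_aemeasurable
      (hf.measurable 0 B).restrict).aestronglyMeasurable (C * ‖B‖ ^ 2 + C) (.of_forall fun z => ?_)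
    have : 0 ≤ C * ‖B‖ ^ 2 := by positivity
    exact abs_le.2 ⟨by linarith [hlo' z], hup' z⟩
  refine ⟨∫ z in unitCube, (f z 0 B).toReal, ?_, hmeas, ?_⟩
  · refine (integral_mono hint (integrable_const _) hup').trans (le_of_eq ?_)
    simp
  · exact cubeIntegral_eq_coe hint (.of_forall fun z => (hcell z).trans (hcoe z))

end

end MagnetoHom

end

theorem proposition4p5 (M : Set MagnetoHom.R3) (hM : MagnetoHom.IsInclusionSet M)
    (C : ℝ) (hC : 0 < C) (f : MagnetoHom.R3 → MagnetoHom.Mat3 → MagnetoHom.R3 → EReal)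
    (hf : MagnetoHom.IsEnergyDensity M C f) :
    -- the homogenized density is finite-valued: it is given by a real function `h`
    ∃ h : MagnetoHom.Mat3 → MagnetoHom.R3 → ℝ,
      (∀ G B, MagnetoHom.fhom f G B = (h G B : EReal)) ∧
      -- quadratic growth
      (∃ K : ℝ, 0 < K ∧ ∀ G B,
        1 / K * (‖MagnetoHom.symPart G‖ ^ 2 + ‖B‖ ^ 2) - K ≤ h G B ∧
        h G B ≤ K * (‖G‖ ^ 2 + ‖B‖ ^ 2) + K) ∧
      -- continuity
      (Continuous fun p : MagnetoHom.Mat3 × MagnetoHom.R3 => h p.1 p.2) ∧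
      -- 2-Lipschitz estimate
      (∃ L : ℝ, 0 < L ∧ ∀ (G₀ G₁ : MagnetoHom.Mat3) (B₀ B₁ : MagnetoHom.R3),
        |h G₀ B₀ - h G₁ B₁|
          ≤ L * (1 + ‖G₀‖ + ‖G₁‖ + ‖B₀‖ + ‖B₁‖) * (‖G₀ - G₁‖ + ‖B₀ - B₁‖)) := by
  obtain ⟨c, hc, htr⟩ := MagnetoHom.exists_fhom_le hM hC hf
  have hlow := hf.le_fhom hC
  set K : ℝ := C + 2 * c * C + c with hK
  have hKC : C ≤ K := by
    have : 0 < 2 * c * C := by positivity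
    linarith
  have hKpos : 0 < K := hC.trans_le hKC
  have hup : ∀ G B, MagnetoHom.fhom f G B ≤ ((K * (‖G‖ ^ 2 + ‖B‖ ^ 2) + K : ℝ) : EReal) := by
    intro G B
    obtain ⟨E, hE, hmeas, hEeq⟩ := hf.exists_trivial_energy hC B
    have hB := norm_nonneg B
    have hG := norm_nonneg G
    refine (htr 0 B 1 0 0 0 le_rfl MagnetoHom.isW012_zero MagnetoHom.isPerDivFree_zero hmeas E hEeq
      (2 * C * (‖B‖ + 1)) (by positivity) ?_ G B).trans ?_
    · have h1 : 2 * C * (E + C) ≤ 2 * C * (C * ‖B‖ ^ 2 + C + C) := by gcongr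
      have h2 : 0 ≤ C ^ 2 * (‖B‖ ^ 2 + 4 * ‖B‖) := by positivity
      nlinarith
    · rw [EReal.coe_le_coe_iff]
      simp only [zero_sub, norm_neg, sub_self, norm_zero, add_zero]
      have h1 : 2 * (‖B‖ + 1) * ‖G‖ ≤ 2 * ‖B‖ ^ 2 + 2 + ‖G‖ ^ 2 := by
        nlinarith [sq_nonneg (‖B‖ + 1 - ‖G‖), sq_nonneg (‖B‖ - 1)]
      have h2 : c * C * (2 * (‖B‖ + 1) * ‖G‖) ≤ c * C * (2 * ‖B‖ ^ 2 + 2 + ‖G‖ ^ 2) := by gcongr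
      have h3 : 0 ≤ (c * C + C) * ‖G‖ ^ 2 + c * ‖B‖ ^ 2 + c := by positivity
      rw [hK]
      linarith
  have hne_top : ∀ G B, MagnetoHom.fhom f G B ≠ ⊤ := fun G B =>
    ne_top_of_le_ne_top (EReal.coe_ne_top _) (hup G B)
  have hne_bot : ∀ G B, MagnetoHom.fhom f G B ≠ ⊥ := fun G B =>
    ne_bot_of_le_ne_bot (EReal.coe_ne_bot _) (hlow G B)
  have hcoe : ∀ G B, MagnetoHom.fhom f G B = ((MagnetoHom.fhom f G B).toReal : EReal) := fun G B =>
    (EReal.coe_toReal (hne_top G B) (hne_bot G B)).symm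
  set h : MagnetoHom.Mat3 → MagnetoHom.R3 → ℝ := fun G B => (MagnetoHom.fhom f G B).toReal with hh
  have hlow' : ∀ G B, 1 / C * (‖MagnetoHom.symPart G‖ ^ 2 + ‖B‖ ^ 2) - C ≤ h G B := fun G B => by
    have := hlow G B
    rw [hcoe] at this
    exact EReal.coe_le_coe_iff.1 this
  have hup' : ∀ G B, h G B ≤ K * (‖G‖ ^ 2 + ‖B‖ ^ 2) + K := fun G B => by
    have := hup G B
    rw [hcoe] at this
    exact EReal.coe_le_coe_iff.1 this
  set a : ℝ := 2 * C * (K + 1 + C) with ha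
  have ha0 : 0 < a := by positivity
  have hone : ∀ (G₀ G₁ : MagnetoHom.Mat3) (B₀ B₁ : MagnetoHom.R3), h G₁ B₁ ≤ h G₀ B₀ +
      c * (2 + a) * (1 + ‖G₀‖ + ‖G₁‖ + ‖B₀‖ + ‖B₁‖) * (‖G₀ - G₁‖ + ‖B₀ - B₁‖) := by
    intro G₀ G₁ B₀ B₁
    have n1 := norm_nonneg G₀
    have n2 := norm_nonneg G₁
    have n3 := norm_nonneg B₀
    have n4 := norm_nonneg B₁
    set R : ℝ := 1 + ‖G₀‖ + ‖G₁‖ + ‖B₀‖ + ‖B₁‖ with hR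
    set Δ : ℝ := ‖G₀ - G₁‖ + ‖B₀ - B₁‖ with hΔ
    have hR1 : 1 ≤ R := by linarith
    have hΔ0 : 0 ≤ Δ := by positivity
    have hΔR : Δ ≤ R := by linarith [norm_sub_le G₀ G₁, norm_sub_le B₀ B₁]
    have hquad : ‖G₀‖ ^ 2 + ‖B₀‖ ^ 2 + 1 ≤ R ^ 2 := by
      have h1 : (1 + ‖G₀‖ + ‖B₀‖) ^ 2 ≤ R ^ 2 := by gcongr; linarith
      nlinarith [mul_nonneg n1 n3]
    refine le_of_forall_pos_le_add fun ε hε => ?_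
    obtain ⟨I, ⟨k, φ, D, β, hk, hφ, hβ, hmeas, hI⟩, hIlt⟩ :
        ∃ I ∈ _, I < ((h G₀ B₀ + min ε 1 : ℝ) : EReal) := by
      refine sInf_lt_iff.1 (show MagnetoHom.fhom f G₀ B₀ < _ from ?_)
      rw [hcoe, EReal.coe_lt_coe_iff]
      have : 0 < min ε 1 := lt_min hε one_pos
      linarith
    have hIbot : I ≠ ⊥ := by
      rw [hI]
      exact ne_bot_of_le_ne_bot (EReal.coe_ne_bot _) (hf.le_cubeIntegral hC hφ hβ hmeas)
    lift I to ℝ using ⟨hIlt.ne_top, hIbot⟩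
    rw [EReal.coe_lt_coe_iff] at hIlt
    have hs : 2 * C * (I + C) ≤ ((1 + a) * R) ^ 2 := by
      have h1 : I + C ≤ (K + 1 + C) * R ^ 2 := by
        have h2 := hup' G₀ B₀
        have h3 := min_le_right ε 1
        have h4 : K * (‖G₀‖ ^ 2 + ‖B₀‖ ^ 2 + 1) ≤ K * R ^ 2 := by gcongr
        have h5 : (1 + C) * 1 ≤ (1 + C) * R ^ 2 := by gcongr; exact one_le_pow₀ hR1
        linarith
      calc 2 * C * (I + C) ≤ 2 * C * ((K + 1 + C) * R ^ 2) := by gcongr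
        _ = a * R ^ 2 := by rw [ha]; ring
        _ ≤ (1 + a) ^ 2 * R ^ 2 := by gcongr; nlinarith
        _ = ((1 + a) * R) ^ 2 := by ring
    have hfin := htr G₀ B₀ k φ D β hk hφ hβ hmeas I hI.symm ((1 + a) * R) (by positivity) hs G₁ B₁
    rw [hcoe, EReal.coe_le_coe_iff] at hfin
    have h6 : c * ((1 + a) * R + Δ) * Δ ≤ c * (2 + a) * R * Δ := by
      have : (1 + a) * R + Δ ≤ (2 + a) * R := by linarith
      calc c * ((1 + a) * R + Δ) * Δ ≤ c * ((2 + a) * R) * Δ := by gcongr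
        _ = c * (2 + a) * R * Δ := by ring
    have h7 := min_le_left ε 1
    have h8 : h G₁ B₁ ≤ I + c * ((1 + a) * R + Δ) * Δ := hfin
    linarith
  have hLip : ∀ (G₀ G₁ : MagnetoHom.Mat3) (B₀ B₁ : MagnetoHom.R3), |h G₀ B₀ - h G₁ B₁| ≤
      c * (2 + a) * (1 + ‖G₀‖ + ‖G₁‖ + ‖B₀‖ + ‖B₁‖) * (‖G₀ - G₁‖ + ‖B₀ - B₁‖) := by
    intro G₀ G₁ B₀ B₁
    have h1 := hone G₀ G₁ B₀ B₁
    have h2 := hone G₁ G₀ B₁ B₀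
    rw [norm_sub_rev G₁ G₀, norm_sub_rev B₁ B₀, add_right_comm 1 ‖G₁‖ ‖G₀‖,
      add_right_comm _ ‖B₁‖ ‖B₀‖] at h2
    exact abs_sub_le_iff.2 ⟨by linarith, by linarith⟩
  refine ⟨h, hcoe, ⟨K, hKpos, fun G B => ⟨?_, hup' G B⟩⟩,
    MagnetoHom.continuous_of_lipschitz_of_linear_growth hLip, c * (2 + a), by positivity, hLip⟩
  refine le_trans ?_ (hlow' G B)
  have : 1 / K * (‖MagnetoHom.symPart G‖ ^ 2 + ‖B‖ ^ 2)
      ≤ 1 / C * (‖MagnetoHom.symPart G‖ ^ 2 + ‖B‖ ^ 2) := by gcongr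
  linarith
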